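/- Let $N\ge 1$ and $\alpha\ge 0$, let $[\alpha]$ be the integer part of $\alpha$, and let $\mathcal P_{[\alpha]}$ be the polynomials on $\mathbb R^N$ of degree at most $[\alpha]$. For a locally square-integrable (real- or complex-valued) function $g$ on $\mathbb R^N$ and a cube $Q$ (sides parallel to the axes), let $p_Q(g)\in\mathcal P_{[\alpha]}$ be the unique polynomial such that $(g-p_Q(g))\chi_Q$ has vanishing moments up to order $[\alpha]$. For a family $\mathcal J$ of cubes put \[ \|g\|_{\Lambda_{\alpha,\mathcal J}}=\Big\| \sup_{x\in Q,\,Q\in\mathcal J}\frac1{|Q|^{\alpha/N}}\Big(\frac1{|Q|}\int_Q|g(y)-p_Q(g)(y)|^2\,dy\Big)^{1/2}\Big\|_{L^\infty(dx)}, \] and let $\Lambda_{\alpha,\mathcal J}$ be the set of those $g$ for which this is finite. Write $\Lambda_\alpha$ when $\mathcal J$ consists of all cubes, and $\Lambda_{\alpha,\mathcal D}$ when $\mathcal J=\mathcal D$ is the family of dyadic cubes $\prod_{i=1}^N[(k_i-1)2^n,k_i2^n]$, $n\in\mathbb Z$, $k\in\mathbb Z^N$. Let $Q_0=[-1,1]^N$,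 and let $A\subset L^2(Q_0)$ be the finite-dimensional subspace of the functions with vanishing moments up to order $[\alpha]$ which coincide with a polynomial in $\mathcal P_{[\alpha]}$ on each of the $2^N$ subcubes of $Q_0$ that are products of the intervals $[-1,0]$ and $[0,1]$. Let $p^1,\dots,p^M$ be an orthonormal basis of $A$, extended by $0$ outside $Q_0$, and let \[ \mathcal S_\alpha=\{\,2^{n(N+\alpha)}p^L(2^nx+k): n\in\mathbb Z,\ k\in\mathbb Z^N,\ 1\le L\le M\,\},\qquad A_\alpha(g)=\sup_{p\in\mathcal S_\alpha}|\langle g,p\rangle|, \] where $\langle g,p\rangle=\int g\,\overline{p}$. Theorem. Let $g$ be locally square-integrable. Then $g\in\Lambda_\alpha$ if and only if $g\in\Lambda_{\alpha,\mathcal D}$ and $A_\alpha(g)<\infty$. Moreover there are constants $c,C>0$, depending only on $N$ and $\alpha$, such that \[ c\,\big(\|g\|_{\Lambda_{\alpha,\mathcal D}}+A_\alpha(g)\big)\le\|g\|_{\Lambda_\alpha}\le C\,\big(\|g\|_{\Lambda_{\alpha,\mathcal D}}+A_\alpha(g)\big). \] -/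

import Mathlib

open MeasureTheory
open scoped ENNReal NNReal

namespace DyadicLipschitz

noncomputable section

section Polynomials

variable {𝕜 : Type*} [RCLike 𝕜] {N : ℕ}

/-- The function on `ℝ^N` (scalar field `𝕜 = ℝ` or `ℂ`) given by a polynomial in `N` variables. -/
def polyFun (p : MvPolynomial (Fin N) 𝕜) (x : Fin N → ℝ) : 𝕜 :=
  MvPolynomial.eval (fun i => (x i : 𝕜)) p

/-- All moments of `f` over `Q` of order at most `d` vanish. -/
def VanishingMoments (d : ℕ) (Q : Set (Fin N → ℝ)) (f : (Fin N → ℝ) → 𝕜) : Prop :=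
  ∀ β : Fin N → ℕ, ∑ i, β i ≤ d → ∫ x in Q, f x * ∏ i, (x i : 𝕜) ^ β i = 0

/-- `p` has degree at most `d` and `(g - p) χ_Q` has vanishing moments up to order `d`. -/
def IsMomentPoly (d : ℕ) (Q : Set (Fin N → ℝ)) (g : (Fin N → ℝ) → 𝕜)
    (p : MvPolynomial (Fin N) 𝕜) : Prop :=
  p.totalDegree ≤ d ∧ VanishingMoments d Q (fun x => g x - polyFun p x)

open Classical in
/-- The polynomial `p_Q(g)` of degree at most `d` such that `(g - p_Q(g)) χ_Q` has vanishing
moments up to order `d`. It exists and is unique whenever `Q` is a cube and `g` is integrable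
on `Q`, see `existsUnique_isMomentPoly`. -/
def momentPoly (d : ℕ) (Q : Set (Fin N → ℝ)) (g : (Fin N → ℝ) → 𝕜) : MvPolynomial (Fin N) 𝕜 :=
  if h : ∃ p, IsMomentPoly d Q g p then h.choose else 0

end Polynomials

section Cubes

/-- The closed cube with lower corner `a` and side length `ℓ`. -/
def cube {N : ℕ} (a : Fin N → ℝ) (ℓ : ℝ) : Set (Fin N → ℝ) := Set.Icc a (fun i => a i + ℓ)

/-- The family of all (closed, nondegenerate) cubes with sides parallel to the axes. -/
def allCubes (N : ℕ) : Set (Set (Fin N → ℝ)) :=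
  {Q | ∃ (a : Fin N → ℝ) (ℓ : ℝ), 0 < ℓ ∧ Q = cube a ℓ}

/-- The family `𝒟` of dyadic cubes: products of intervals `[(k_i - 1) 2^n, k_i 2^n]`. -/
def dyadicCubes (N : ℕ) : Set (Set (Fin N → ℝ)) :=
  {Q | ∃ (n : ℤ) (k : Fin N → ℤ),
    Q = Set.Icc (fun i => ((k i : ℝ) - 1) * 2 ^ n) (fun i => (k i : ℝ) * 2 ^ n)}

/-- The cube `Q₀ = [-1, 1]^N`. -/
def unitCube (N : ℕ) : Set (Fin N → ℝ) := Set.Icc (fun _ => -1) (fun _ => 1)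

/-- The `2^N` dyadic subcubes of `Q₀`: products of the intervals `[-1, 0]` and `[0, 1]`. -/
def subcube {N : ℕ} (S : Fin N → Bool) : Set (Fin N → ℝ) :=
  Set.Icc (fun i => if S i then 0 else -1) (fun i => if S i then 1 else 0)

end Cubes

section Lipschitz

variable {𝕜 : Type*} [RCLike 𝕜] {N : ℕ}

/-- `g` is (measurable and) square-integrable on every compact set. -/
def LocallySquareIntegrable (g : (Fin N → ℝ) → 𝕜) : Prop :=
  ∀ K : Set (Fin N → ℝ), IsCompact K → MemLp g 2 (volume.restrict K)

/-- The mean oscillation `|Q|^{-α/N} (|Q|⁻¹ ∫_Q |g - p_Q(g)|²)^{1/2}`, `p_Q(g)` of degree at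
most `[α]`. -/
def oscillation (α : ℝ) (g : (Fin N → ℝ) → 𝕜) (Q : Set (Fin N → ℝ)) : ℝ≥0∞ :=
  (1 / volume Q ^ (α / N)) *
    ((1 / volume Q) * ∫⁻ y in Q, ‖g y - polyFun (momentPoly ⌊α⌋₊ Q g) y‖ₑ ^ 2) ^ (1 / 2 : ℝ)

/-- The maximal function: the supremum of the oscillations over the cubes of the family `J`
that contain `x`. -/
def sharpMaximal (α : ℝ) (J : Set (Set (Fin N → ℝ))) (g : (Fin N → ℝ) → 𝕜)
    (x : Fin N → ℝ) : ℝ≥0∞ :=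
  ⨆ Q ∈ J, ⨆ _ : x ∈ Q, oscillation α g Q

/-- The norm `‖g‖_{Λ_{α,J}}`, as an extended nonnegative real: the essential supremum of the
maximal function. -/
def lipNorm (α : ℝ) (J : Set (Set (Fin N → ℝ))) (g : (Fin N → ℝ) → 𝕜) : ℝ≥0∞ :=
  essSup (sharpMaximal α J g) volume

/-- Membership in the space `Λ_{α,J}`. -/
def MemLip (α : ℝ) (J : Set (Set (Fin N → ℝ))) (g : (Fin N → ℝ) → 𝕜) : Prop :=
  LocallySquareIntegrable g ∧ lipNorm α J g < ∞

end Lipschitz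

section HelperFacts

variable {𝕜 : Type*} [RCLike 𝕜] {N : ℕ}

lemma continuous_polyFun (p : MvPolynomial (Fin N) 𝕜) : Continuous (polyFun p) :=
  (MvPolynomial.continuous_eval p).comp
    (continuous_pi fun i => RCLike.continuous_ofReal.comp (continuous_apply i))

lemma polyFun_add (p q : MvPolynomial (Fin N) 𝕜) (x : Fin N → ℝ) :
    polyFun (p + q) x = polyFun p x + polyFun q x := by simp [polyFun]

lemma polyFun_sub (p q : MvPolynomial (Fin N) 𝕜) (x : Fin N → ℝ) :
    polyFun (p - q) x = polyFun p x - polyFun q x := by simp [polyFun]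

lemma polyFun_smul (c : 𝕜) (p : MvPolynomial (Fin N) 𝕜) (x : Fin N → ℝ) :
    polyFun (c • p) x = c * polyFun p x := by simp [polyFun, MvPolynomial.smul_eval]

lemma integrableOn_mul_polyFun {f : (Fin N → ℝ) → 𝕜} {a b : Fin N → ℝ}
    (hf : IntegrableOn f (Set.Icc a b)) (q : MvPolynomial (Fin N) 𝕜) :
    IntegrableOn (fun x => f x * polyFun q x) (Set.Icc a b) :=
  hf.mul_continuousOn (continuous_polyFun q).continuousOn isCompact_Icc

lemma integrableOn_polyFun (a b : Fin N → ℝ) (q : MvPolynomial (Fin N) 𝕜) :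
    IntegrableOn (polyFun q) (Set.Icc a b) :=
  (continuous_polyFun q).continuousOn.integrableOn_compact isCompact_Icc

/-- The linear functional `q ↦ ∫_Q f q` on polynomials of degree at most `d`. -/
def momentFunctional (d : ℕ) (a b : Fin N → ℝ) (f : (Fin N → ℝ) → 𝕜)
    (hf : IntegrableOn f (Set.Icc a b)) :
    Module.Dual 𝕜 (MvPolynomial.restrictTotalDegree (Fin N) 𝕜 d) where
  toFun q := ∫ x in Set.Icc a b, f x * polyFun q.1 x
  map_add' p q := by
    simp only [Submodule.coe_add, polyFun_add, mul_add]
    exact integral_add (integrableOn_mul_polyFun hf _) (integrableOn_mul_polyFun hf _)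
  map_smul' c p := by
    simp only [Submodule.coe_smul, polyFun_smul, RingHom.id_apply, smul_eq_mul]
    rw [← integral_const_mul]
    congr 1; ext x; ring

lemma momentFunctional_eq_zero_iff (d : ℕ) (a b : Fin N → ℝ) (f : (Fin N → ℝ) → 𝕜)
    (hf : IntegrableOn f (Set.Icc a b)) :
    momentFunctional d a b f hf = 0 ↔ VanishingMoments d (Set.Icc a b) f := by
  have key : ∀ β : Fin N →₀ ℕ, ∀ x : Fin N → ℝ,
      polyFun (MvPolynomial.monomial β (1 : 𝕜)) x = ∏ i, (x i : 𝕜) ^ β i := by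
    intro β x
    simp [polyFun, MvPolynomial.eval_monomial, Finsupp.prod_fintype]
  constructor
  · intro h β hβ
    have hm : MvPolynomial.monomial (Finsupp.equivFunOnFinite.symm β) (1 : 𝕜) ∈
        MvPolynomial.restrictTotalDegree (Fin N) 𝕜 d := by
      rw [MvPolynomial.mem_restrictTotalDegree]
      refine (MvPolynomial.totalDegree_monomial_le _ _).trans ?_
      rw [Finsupp.sum_fintype _ _ (fun _ => rfl)]
      simpa using hβ
    have := LinearMap.congr_fun h ⟨_, hm⟩
    simpa [momentFunctional, key] using this
  · intro h
    ext q
    obtain ⟨q, hq⟩ := q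
    rw [MvPolynomial.mem_restrictTotalDegree] at hq
    change ∫ x in Set.Icc a b, f x * polyFun q x = 0
    have e : ∀ x, f x * polyFun q x
        = ∑ β ∈ q.support, q.coeff β * (f x * ∏ i, (x i : 𝕜) ^ β i) := by
      intro x
      rw [polyFun, MvPolynomial.eval_eq', Finset.mul_sum]
      exact Finset.sum_congr rfl fun β _ => by ring
    simp_rw [e]
    rw [integral_finsetSum]
    · refine Finset.sum_eq_zero fun β hβ => ?_
      rw [integral_const_mul, h β, mul_zero]
      have := (MvPolynomial.le_totalDegree hβ).trans hq
      rwa [Finsupp.sum_fintype _ _ (fun _ => rfl)] at this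
    · intro β _
      refine Integrable.const_mul ?_ _
      have := integrableOn_mul_polyFun hf (MvPolynomial.monomial β (1 : 𝕜))
      simp_rw [key] at this
      exact this

/-- A polynomial that is orthogonal on a nondegenerate box to all polynomials of degree at most
its own is zero. -/
lemma poly_eq_zero_of_orthogonal {d : ℕ} {a b : Fin N → ℝ} (hab : ∀ i, a i < b i)
    {p : MvPolynomial (Fin N) 𝕜} (hp : p.totalDegree ≤ d)
    (h : ∀ q : MvPolynomial (Fin N) 𝕜, q.totalDegree ≤ d →
      ∫ x in Set.Icc a b, polyFun p x * polyFun q x = 0) : p = 0 := by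
  have hconj : ∀ x, polyFun (MvPolynomial.map (starRingEnd 𝕜) p) x
      = starRingEnd 𝕜 (polyFun p x) := by
    intro x
    rw [polyFun, polyFun, MvPolynomial.eval_map, MvPolynomial.eval, MvPolynomial.coe_eval₂Hom,
      MvPolynomial.hom_eval₂]
    simp
  have h1 := h (MvPolynomial.map (starRingEnd 𝕜) p)
    ((Finset.sup_mono (MvPolynomial.support_map_subset _ _)).trans hp)
  simp_rw [hconj, RCLike.mul_conj] at h1
  have h2 : ∫ x in Set.Icc a b, ‖polyFun p x‖ ^ 2 = 0 := by
    have : ((∫ x in Set.Icc a b, ‖polyFun p x‖ ^ 2 : ℝ) : 𝕜) = 0 := by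
      rw [← integral_ofReal]
      simpa using h1
    exact_mod_cast this
  have hc : Continuous fun x => ‖polyFun p x‖ ^ 2 := (continuous_polyFun p).norm.pow 2
  have hi : IntegrableOn (fun x => ‖polyFun p x‖ ^ 2) (Set.Icc a b) :=
    hc.continuousOn.integrableOn_compact isCompact_Icc
  rw [integral_eq_zero_iff_of_nonneg (fun x => by positivity) hi] at h2
  have hs : Set.pi Set.univ (fun i => Set.Ioo (a i) (b i)) ⊆ Set.Icc a b := by
    intro x hx
    exact ⟨fun i => (hx i trivial).1.le, fun i => (hx i trivial).2.le⟩
  have ho : IsOpen (Set.pi Set.univ (fun i => Set.Ioo (a i) (b i))) :=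
    isOpen_set_pi Set.finite_univ fun i _ => isOpen_Ioo
  have h3 := Measure.eqOn_open_of_ae_eq (ae_restrict_of_ae_restrict_of_subset hs h2) ho
    hc.continuousOn continuousOn_const
  refine MvPolynomial.funext_set (fun i => (fun t : ℝ => (t : 𝕜)) '' Set.Ioo (a i) (b i))
    (fun i => (Set.Ioo_infinite (hab i)).image RCLike.ofReal_injective.injOn) fun y hy => ?_
  choose x hx hxy using fun i => hy i trivial
  have h4 := h3 (show x ∈ Set.pi Set.univ (fun i => Set.Ioo (a i) (b i)) from fun i _ => hx i)
  have h5 : polyFun p x = 0 := by simpa using h4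
  rw [map_zero, ← h5, polyFun]
  congr 2
  ext i
  exact (hxy i).symm

/-- Existence and uniqueness of `p_Q(g)`. -/
theorem existsUnique_isMomentPoly (d : ℕ) {a : Fin N → ℝ} {ℓ : ℝ} (hℓ : 0 < ℓ)
    {g : (Fin N → ℝ) → 𝕜} (hg : IntegrableOn g (cube a ℓ)) :
    ∃! p, IsMomentPoly d (cube a ℓ) g p := by
  unfold cube at hg ⊢
  set b : Fin N → ℝ := fun i => a i + ℓ with hb
  have hab : ∀ i, a i < b i := fun i => by simp [hb, hℓ]
  let V := MvPolynomial.restrictTotalDegree (Fin N) 𝕜 d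
  let T : V →ₗ[𝕜] Module.Dual 𝕜 V :=
    { toFun := fun p => momentFunctional d a b (polyFun p.1) (integrableOn_polyFun a b _)
      map_add' := fun p q => by
        ext r
        simp only [momentFunctional, LinearMap.coe_mk, AddHom.coe_mk, Submodule.coe_add,
          polyFun_add, add_mul, LinearMap.add_apply]
        exact integral_add (integrableOn_mul_polyFun (integrableOn_polyFun a b _) _)
          (integrableOn_mul_polyFun (integrableOn_polyFun a b _) _)
      map_smul' := fun c p => by
        ext r
        simp only [momentFunctional, LinearMap.coe_mk, AddHom.coe_mk, Submodule.coe_smul,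
          polyFun_smul, mul_assoc, LinearMap.smul_apply, RingHom.id_apply, smul_eq_mul]
        exact integral_const_mul _ _ }
  have hinj : Function.Injective T := by
    rw [injective_iff_map_eq_zero]
    intro p hp
    refine Subtype.ext (poly_eq_zero_of_orthogonal (d := d) hab
      ((MvPolynomial.mem_restrictTotalDegree _ _ _).1 p.2) fun q hq => ?_)
    exact LinearMap.congr_fun hp ⟨q, (MvPolynomial.mem_restrictTotalDegree _ _ _).2 hq⟩
  have hsurj : Function.Surjective T :=
    (LinearMap.injective_iff_surjective_of_finrank_eq_finrank Subspace.dual_finrank_eq.symm).1 hinj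
  have hT : ∀ p : V, T p = momentFunctional d a b g hg ↔ IsMomentPoly d (Set.Icc a b) g p.1 := by
    intro p
    have hi : IntegrableOn (fun x => g x - polyFun p.1 x) (Set.Icc a b) :=
      hg.sub (integrableOn_polyFun a b _)
    have hdeg := (MvPolynomial.mem_restrictTotalDegree (Fin N) d p.1).1 p.2
    have : momentFunctional d a b _ hi = momentFunctional d a b g hg - T p := by
      ext r
      simp only [momentFunctional, LinearMap.coe_mk, AddHom.coe_mk, sub_mul,
        LinearMap.sub_apply, T]
      exact integral_sub (integrableOn_mul_polyFun hg _)
        (integrableOn_mul_polyFun (integrableOn_polyFun a b _) _)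
    rw [IsMomentPoly, ← momentFunctional_eq_zero_iff d a b _ hi, this, sub_eq_zero, eq_comm]
    exact ⟨fun h => ⟨hdeg, h⟩, fun h => h.2⟩
  obtain ⟨p, hp⟩ := hsurj (momentFunctional d a b g hg)
  refine ⟨p.1, (hT p).1 hp, fun q hq => ?_⟩
  have h1 := (hT ⟨q, (MvPolynomial.mem_restrictTotalDegree _ _ _).2 hq.1⟩).2 hq
  exact congrArg Subtype.val (hinj (h1.trans hp.symm))

end HelperFacts

section Splines

variable (𝕜 : Type*) [RCLike 𝕜] (N d : ℕ)

lemma lp_integrable {𝕜 : Type*} [RCLike 𝕜] {N : ℕ}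
    (f : Lp 𝕜 2 (volume.restrict (unitCube N))) : IntegrableOn f (unitCube N) := by
  have : IsFiniteMeasure (volume.restrict (unitCube N)) :=
    isFiniteMeasure_restrict.2 (by unfold unitCube; exact isCompact_Icc.measure_lt_top.ne)
  exact (Lp.memLp f).integrable (by norm_num)

lemma subcube_subset {N : ℕ} (S : Fin N → Bool) : subcube S ⊆ unitCube N := by
  intro x hx
  constructor <;> intro i
  · have := hx.1 i
    simp only at this ⊢
    split_ifs at this <;> linarith
  · have := hx.2 i
    simp only at this ⊢
    split_ifs at this <;> linarith

/-- The subspace `A` of `L²(Q₀)`: the functions with vanishing moments up to order `d` which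
coincide with a polynomial of degree at most `d` on each of the `2^N` dyadic subcubes of `Q₀`. -/
def splineSpace : Submodule 𝕜 (Lp 𝕜 2 (volume.restrict (unitCube N))) where
  carrier := {f | VanishingMoments d (unitCube N) f ∧
    ∀ S : Fin N → Bool, ∃ p : MvPolynomial (Fin N) 𝕜, p.totalDegree ≤ d ∧
      ∀ᵐ x ∂(volume.restrict (subcube S)), f x = polyFun p x}
  zero_mem' := by
    have h0 := Lp.coeFn_zero 𝕜 2 (volume.restrict (unitCube N))
    refine ⟨fun β _ => ?_, fun S => ⟨0, by simp, ?_⟩⟩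
    · refine integral_eq_zero_of_ae ?_
      filter_upwards [h0] with x hx
      rw [hx]; simp
    · filter_upwards [ae_restrict_of_ae_restrict_of_subset (subcube_subset S) h0] with x hx
      rw [hx]; simp [polyFun]
  add_mem' := by
    rintro f g ⟨hf1, hf2⟩ ⟨hg1, hg2⟩
    have h0 := Lp.coeFn_add f g
    refine ⟨?_, fun S => ?_⟩
    · have hf := lp_integrable f
      have hg := lp_integrable g
      have hfg := lp_integrable (f + g)
      unfold unitCube at *
      rw [← momentFunctional_eq_zero_iff d _ _ _ hf] at hf1
      rw [← momentFunctional_eq_zero_iff d _ _ _ hg] at hg1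
      rw [← momentFunctional_eq_zero_iff d _ _ _ hfg]
      ext q
      have hf1 := LinearMap.congr_fun hf1 q
      have hg1 := LinearMap.congr_fun hg1 q
      simp only [momentFunctional, LinearMap.coe_mk, AddHom.coe_mk, LinearMap.zero_apply]
        at hf1 hg1 ⊢
      rw [← add_zero (0 : 𝕜)]
      nth_rewrite 1 [← hf1]
      rw [← hg1, ← integral_add (integrableOn_mul_polyFun hf _) (integrableOn_mul_polyFun hg _)]
      refine integral_congr_ae ?_
      filter_upwards [h0] with x hx
      rw [hx, Pi.add_apply, add_mul]
    · obtain ⟨p, hp, hpf⟩ := hf2 S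
      obtain ⟨q, hq, hqg⟩ := hg2 S
      refine ⟨p + q, (MvPolynomial.totalDegree_add p q).trans (max_le hp hq), ?_⟩
      filter_upwards [hpf, hqg, ae_restrict_of_ae_restrict_of_subset (subcube_subset S) h0]
        with x h1 h2 h3
      rw [h3, Pi.add_apply, h1, h2, polyFun_add]
  smul_mem' := by
    rintro c f ⟨hf1, hf2⟩
    have h0 := Lp.coeFn_smul c f
    refine ⟨fun β hβ => ?_, fun S => ?_⟩
    · rw [← mul_zero c, ← hf1 β hβ, ← integral_const_mul]
      refine integral_congr_ae ?_
      filter_upwards [h0] with x hx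
      rw [hx, Pi.smul_apply, smul_eq_mul, mul_assoc]
    · obtain ⟨p, hp, hpf⟩ := hf2 S
      refine ⟨c • p, (MvPolynomial.totalDegree_smul_le c p).trans hp, ?_⟩
      filter_upwards [hpf, ae_restrict_of_ae_restrict_of_subset (subcube_subset S) h0]
        with x h1 h3
      rw [h3, Pi.smul_apply, h1, polyFun_smul, smul_eq_mul]

/-- The space `A` is finite dimensional, so it has finite orthonormal bases. -/
instance finiteDimensional_splineSpace : FiniteDimensional 𝕜 (splineSpace 𝕜 N d) := by
  have hint : ∀ (f : Lp 𝕜 2 (volume.restrict (unitCube N))) (S : Fin N → Bool),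
      IntegrableOn f (subcube S) := fun f S => (lp_integrable f).mono_set (subcube_subset S)
  let V := MvPolynomial.restrictTotalDegree (Fin N) 𝕜 d
  let T : splineSpace 𝕜 N d →ₗ[𝕜] ((Fin N → Bool) → Module.Dual 𝕜 V) :=
    { toFun := fun f S => momentFunctional d _ _ f.1 (hint f.1 S)
      map_add' := fun f g => by
        ext S q
        have h0 := ae_restrict_of_ae_restrict_of_subset (subcube_subset S)
          (Lp.coeFn_add f.1 g.1)
        simp only [momentFunctional, LinearMap.coe_mk, AddHom.coe_mk, Pi.add_apply,
          LinearMap.add_apply]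
        rw [← integral_add (integrableOn_mul_polyFun (hint f.1 S) _)
          (integrableOn_mul_polyFun (hint g.1 S) _)]
        refine integral_congr_ae ?_
        filter_upwards [h0] with x hx
        rw [Submodule.coe_add, hx, Pi.add_apply, add_mul]
      map_smul' := fun c f => by
        ext S q
        have h0 := ae_restrict_of_ae_restrict_of_subset (subcube_subset S)
          (Lp.coeFn_smul c f.1)
        simp only [momentFunctional, LinearMap.coe_mk, AddHom.coe_mk, Pi.smul_apply,
          LinearMap.smul_apply, RingHom.id_apply, smul_eq_mul]
        rw [← integral_const_mul]
        refine integral_congr_ae ?_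
        filter_upwards [h0] with x hx
        rw [Submodule.coe_smul, hx, Pi.smul_apply, smul_eq_mul, mul_assoc] }
  refine Module.Finite.of_injective T ?_
  rw [injective_iff_map_eq_zero]
  intro f hf
  have hS : ∀ S : Fin N → Bool, ∀ᵐ x ∂(volume.restrict (subcube S)), f.1 x = 0 := by
    intro S
    obtain ⟨p, hp, hpf⟩ := f.2.2 S
    have hp0 : p = 0 := by
      refine poly_eq_zero_of_orthogonal (d := d)
        (a := fun i => if S i then (0 : ℝ) else -1) (b := fun i => if S i then (1 : ℝ) else 0)
        (fun i => ?_) hp fun q hq => ?_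
      · split_ifs <;> norm_num
      · have := LinearMap.congr_fun (congrFun hf S)
          ⟨q, (MvPolynomial.mem_restrictTotalDegree _ _ _).2 hq⟩
        refine Eq.trans (integral_congr_ae ?_) this
        filter_upwards [hpf] with x hx
        rw [hx]
    filter_upwards [hpf] with x hx
    rw [hx, hp0]; simp [polyFun]
  have hcover : unitCube N ⊆ ⋃ S : Fin N → Bool, subcube S := by
    intro x hx
    refine Set.mem_iUnion.2 ⟨fun i => decide (0 ≤ x i), fun i => ?_, fun i => ?_⟩
    · by_cases h : 0 ≤ x i
      · simp [h]
      · simpa [h] using hx.1 i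
    · by_cases h : 0 ≤ x i
      · simpa [h] using hx.2 i
      · simpa [h] using (not_le.1 h).le
  refine Subtype.ext (Lp.ext ?_)
  have h1 : ∀ᵐ x ∂(volume.restrict (unitCube N)), f.1 x = 0 :=
    ae_restrict_of_ae_restrict_of_subset hcover ((ae_restrict_iUnion_iff _ _).2 hS)
  filter_upwards [h1, Lp.coeFn_zero 𝕜 2 (volume.restrict (unitCube N))] with x hx h0
  rw [hx]
  exact h0.symm

variable {𝕜 N d}

/-- The dilated and translated spline `x ↦ 2^{n(N+α)} p(2^n x + k)`, where `p ∈ L²(Q₀)` is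
extended by zero outside `Q₀`. -/
def dilatedSpline (α : ℝ) (p : Lp 𝕜 2 (volume.restrict (unitCube N))) (n : ℤ) (k : Fin N → ℤ)
    (x : Fin N → ℝ) : 𝕜 :=
  (((2 : ℝ) ^ ((n : ℝ) * (N + α)) : ℝ) : 𝕜) *
    (unitCube N).indicator p (fun i => 2 ^ n * x i + k i)

/-- The family `𝒮_α` of special splines obtained from the orthonormal basis `b` of `A`. -/
def specialSplines (α : ℝ) {M : ℕ} (b : OrthonormalBasis (Fin M) 𝕜 (splineSpace 𝕜 N ⌊α⌋₊)) :
    Set ((Fin N → ℝ) → 𝕜) :=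
  {s | ∃ (n : ℤ) (k : Fin N → ℤ) (L : Fin M), s = dilatedSpline α (b L).1 n k}

/-- `⟨g, s⟩ = ∫ g s̄`. -/
def pairing (g s : (Fin N → ℝ) → 𝕜) : 𝕜 := ∫ x, g x * starRingEnd 𝕜 (s x)

/-- `A_α(g) = sup_{s ∈ 𝒮_α} |⟨g, s⟩|`, as an extended nonnegative real. -/
def splineSup (α : ℝ) {M : ℕ} (b : OrthonormalBasis (Fin M) 𝕜 (splineSpace 𝕜 N ⌊α⌋₊))
    (g : (Fin N → ℝ) → 𝕜) : ℝ≥0∞ :=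
  ⨆ s ∈ specialSplines α b, ‖pairing g s‖ₑ

end Splines

end

end DyadicLipschitz

/-!
The `L²(Q)` distance from `g` to the polynomials of degree at most `d` is monotone in `Q`, and up to
the normalising power of the side length it is the oscillation of `g` on `Q`, so the oscillation on
an arbitrary cube is controlled by that on any comparable larger one. Every cube is contained in
a cube of at most four times its side which, although not dyadic, is a union of `2 ^ N` dyadic
cubes. After rescaling this union is `Q₀`, where the best approximations on the subcubes differ from
a single polynomial by an element of the spline space, and the inner products with its basis bound
the component of `g` in that space.
-/

namespace DyadicLipschitz

section Hilbert

variable {𝕜 E ι : Type*} [RCLike 𝕜] [NormedAddCommGroup E] [InnerProductSpace 𝕜 E]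

lemma enorm_le_enorm_add_of_inner_eq_zero {x y : E} (h : inner 𝕜 x y = 0) :
    ‖x‖ₑ ≤ ‖x + y‖ₑ := by
  rw [enorm_le_iff_norm_le, ← sq_le_sq₀ (norm_nonneg _) (norm_nonneg _), sq, sq,
    norm_add_sq_eq_norm_sq_add_norm_sq_of_inner_eq_zero x y h]
  exact le_add_of_nonneg_right (mul_self_nonneg _)

lemma enorm_inner_le_enorm_sub {v x y : E} (hv : ‖v‖ = 1) (h : inner 𝕜 v y = 0) :
    ‖inner 𝕜 v x‖ₑ ≤ ‖x - y‖ₑ := by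
  rw [enorm_le_iff_norm_le, ← sub_zero (inner 𝕜 v x), ← h, ← inner_sub_right]
  simpa only [hv, one_mul] using norm_inner_le_norm (𝕜 := 𝕜) v (x - y)

lemma enorm_starProjection_le_sum [Fintype ι] {K : Submodule 𝕜 E} [K.HasOrthogonalProjection]
    (b : OrthonormalBasis ι 𝕜 K) (x : E) :
    ‖K.starProjection x‖ₑ ≤ ∑ i, ‖inner 𝕜 (b i : E) x‖ₑ := by
  have hb (i : ι) : ‖(b i : E)‖ₑ = 1 := by
    rw [← ofReal_norm, Submodule.norm_coe, b.orthonormal.1 i, ENNReal.ofReal_one]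
  have hx : K.starProjection x = ∑ i, inner 𝕜 (b i : E) x • (b i : E) := by
    rw [K.starProjection_apply, b.orthogonalProjectionOnto_apply_eq_sum]
    simp only [Submodule.coe_sum, Submodule.coe_smul]
  rw [hx]
  refine (enorm_sum_le _ _).trans_eq (Finset.sum_congr rfl fun i _ => ?_)
  rw [enorm_smul, hb, mul_one]

/-- Both `x - q` and `x - u` have the same component orthogonal to `K`. -/
lemma enorm_sub_le_of_mem_orthogonal {K : Submodule 𝕜 E} [K.HasOrthogonalProjection]
    {x u q : E} (hq : q ∈ Kᗮ) (hu : u - q ∈ K) :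
    ‖x - q‖ₑ ≤ ‖x - u‖ₑ + ‖K.starProjection x‖ₑ := by
  have hq0 : K.starProjection q = 0 := K.starProjection_apply_eq_zero_iff.2 hq
  have huq : Kᗮ.starProjection (u - q) = 0 :=
    Kᗮ.starProjection_apply_eq_zero_iff.2 (K.le_orthogonal_orthogonal hu)
  have horth : Kᗮ.starProjection (x - q) = Kᗮ.starProjection (x - u) := by
    rw [← sub_add_sub_cancel x u q, map_add, huq, add_zero]
  have hdecomp : x - q = Kᗮ.starProjection (x - u) + K.starProjection x := by
    rw [← horth, ← sub_zero (K.starProjection x), ← hq0, ← map_sub, add_comm,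
      K.starProjection_add_starProjection_orthogonal]
  rw [hdecomp]
  refine (enorm_add_le _ _).trans (add_le_add_left ?_ _)
  exact enorm_le_iff_norm_le.2 (Kᗮ.norm_starProjection_apply_le _)

end Hilbert

section Polynomials

variable {𝕜 : Type*} [RCLike 𝕜] {N d : ℕ}

lemma totalDegree_bind₁_le {R σ τ : Type*} [CommSemiring R] {f : σ → MvPolynomial τ R} {m : ℕ}
    (hf : ∀ i, (f i).totalDegree ≤ m) (p : MvPolynomial σ R) :
    (MvPolynomial.bind₁ f p).totalDegree ≤ p.totalDegree * m := by
  rw [MvPolynomial.bind₁, MvPolynomial.aeval_def, MvPolynomial.eval₂_eq]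
  refine MvPolynomial.totalDegree_finsetSum_le fun β hβ => ?_
  refine (MvPolynomial.totalDegree_mul _ _).trans ?_
  rw [MvPolynomial.algebraMap_eq, MvPolynomial.totalDegree_C, zero_add]
  refine (MvPolynomial.totalDegree_finsetProd _ _).trans ?_
  calc ∑ i ∈ β.support, (f i ^ β i).totalDegree
      ≤ ∑ i ∈ β.support, β i * m := Finset.sum_le_sum fun i _ =>
        (MvPolynomial.totalDegree_pow _ _).trans (Nat.mul_le_mul_left _ (hf i))
    _ = (β.sum fun _ e => e) * m := (Finset.sum_mul _ _ _).symm
    _ ≤ p.totalDegree * m := Nat.mul_le_mul_right _ (MvPolynomial.le_totalDegree hβ)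

lemma exists_polyFun_eq_conj (p : MvPolynomial (Fin N) 𝕜) :
    ∃ q : MvPolynomial (Fin N) 𝕜, q.totalDegree ≤ p.totalDegree ∧
      ∀ x, polyFun q x = starRingEnd 𝕜 (polyFun p x) := by
  refine ⟨MvPolynomial.map (starRingEnd 𝕜) p,
    Finset.sup_mono (MvPolynomial.support_map_subset _ _), fun x => ?_⟩
  rw [polyFun, polyFun, MvPolynomial.map_eval]
  simp only [Function.comp_def, RCLike.conj_ofReal]

lemma exists_polyFun_eq_comp_affine (s : ℝ) (t : Fin N → ℝ) (p : MvPolynomial (Fin N) 𝕜) :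
    ∃ q : MvPolynomial (Fin N) 𝕜, q.totalDegree ≤ p.totalDegree ∧
      polyFun q = polyFun p ∘ fun x => s • x + t := by
  let f : Fin N → MvPolynomial (Fin N) 𝕜 := fun i =>
    MvPolynomial.C (s : 𝕜) * MvPolynomial.X i + MvPolynomial.C (t i : 𝕜)
  have hf (i : Fin N) : (f i).totalDegree ≤ 1 := by
    refine (MvPolynomial.totalDegree_add _ _).trans (max_le ?_ (by simp))
    exact (MvPolynomial.totalDegree_mul _ _).trans (by simp)
  refine ⟨MvPolynomial.bind₁ f p, (totalDegree_bind₁_le hf p).trans_eq (mul_one _), ?_⟩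
  have hfx (x : Fin N → ℝ) (i : Fin N) : MvPolynomial.eval (fun j => (x j : 𝕜)) (f i) =
      ((s • x + t) i : ℝ) := by simp [f]
  ext x
  exact (MvPolynomial.eval₂Hom_bind₁ _ _ _ _).trans
    (congrArg (fun y => MvPolynomial.eval y p) (funext (hfx x)))

lemma locallySquareIntegrable_of_continuous {f : (Fin N → ℝ) → 𝕜} (hf : Continuous f) :
    LocallySquareIntegrable f := by
  intro K hK
  have : IsFiniteMeasure (volume.restrict K) := isFiniteMeasure_restrict.2 hK.measure_lt_top.ne
  obtain ⟨C, hC⟩ := hK.exists_bound_of_continuousOn hf.continuousOn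
  exact MemLp.of_bound hf.aestronglyMeasurable C (ae_restrict_of_forall_mem hK.measurableSet hC)

lemma memLp_polyFun {K : Set (Fin N → ℝ)} (hK : IsCompact K) (p : MvPolynomial (Fin N) 𝕜) :
    MemLp (polyFun p) 2 (volume.restrict K) :=
  locallySquareIntegrable_of_continuous (continuous_polyFun p) K hK

lemma integrableOn_of_memLp_two {K : Set (Fin N → ℝ)} (hK : IsCompact K) {f : (Fin N → ℝ) → 𝕜}
    (hf : MemLp f 2 (volume.restrict K)) : IntegrableOn f K := by
  have : IsFiniteMeasure (volume.restrict K) := isFiniteMeasure_restrict.2 hK.measure_lt_top.ne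
  exact hf.integrable one_le_two

lemma inner_toLp {X : Type*} [MeasurableSpace X] {μ : Measure X} (f : Lp 𝕜 2 μ) {g : X → 𝕜}
    (hg : MemLp g 2 μ) : inner 𝕜 f (hg.toLp g) = ∫ x, g x * starRingEnd 𝕜 (f x) ∂μ := by
  rw [L2.inner_def]
  refine integral_congr_ae ?_
  filter_upwards [hg.coeFn_toLp] with x hx
  rw [hx, RCLike.inner_apply]

lemma VanishingMoments.congr_ae {Q : Set (Fin N → ℝ)} {f g : (Fin N → ℝ) → 𝕜}
    (hf : VanishingMoments d Q f) (hfg : f =ᵐ[volume.restrict Q] g) : VanishingMoments d Q g :=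
  fun β hβ => (integral_congr_ae (hfg.mono fun x hx => by simp only [hx])).symm.trans (hf β hβ)

lemma VanishingMoments.inner_polyFun {a b : Fin N → ℝ}
    {f : Lp 𝕜 2 (volume.restrict (Set.Icc a b))} (hf : VanishingMoments d (Set.Icc a b) f)
    {q : MvPolynomial (Fin N) 𝕜} (hq : q.totalDegree ≤ d) :
    inner 𝕜 f ((memLp_polyFun isCompact_Icc q).toLp _) = 0 := by
  obtain ⟨r, hr, hrq⟩ := exists_polyFun_eq_conj q
  have hfi : IntegrableOn f (Set.Icc a b) := integrableOn_of_memLp_two isCompact_Icc (Lp.memLp f)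
  have hfr : ∫ x in Set.Icc a b, f x * polyFun r x = 0 :=
    LinearMap.congr_fun ((momentFunctional_eq_zero_iff d a b f hfi).2 hf)
      ⟨r, (MvPolynomial.mem_restrictTotalDegree _ _ _).2 (hr.trans hq)⟩
  rw [inner_toLp, ← map_zero (starRingEnd 𝕜), ← hfr, ← integral_conj]
  simp only [map_mul, hrq, RCLike.conj_conj, mul_comm]

/-- The distance in `L²(Q)` from `g` to the polynomials of degree at most `d`. -/
noncomputable def polyDist (d : ℕ) (Q : Set (Fin N → ℝ)) (g : (Fin N → ℝ) → 𝕜) : ℝ≥0∞ :=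
  ⨅ (p : MvPolynomial (Fin N) 𝕜) (_ : p.totalDegree ≤ d),
    eLpNorm (g - polyFun p) 2 (volume.restrict Q)

lemma polyDist_le {Q : Set (Fin N → ℝ)} {g : (Fin N → ℝ) → 𝕜} {p : MvPolynomial (Fin N) 𝕜}
    (hp : p.totalDegree ≤ d) :
    polyDist d Q g ≤ eLpNorm (g - polyFun p) 2 (volume.restrict Q) :=
  iInf₂_le p hp

lemma polyDist_mono {Q Q' : Set (Fin N → ℝ)} (h : Q ⊆ Q') (g : (Fin N → ℝ) → 𝕜) :
    polyDist d Q g ≤ polyDist d Q' g :=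
  iInf₂_mono fun _ _ => eLpNorm_mono_measure _ (Measure.restrict_mono h le_rfl)

lemma IsMomentPoly.eLpNorm_sub_eq_polyDist {a b : Fin N → ℝ} {g : (Fin N → ℝ) → 𝕜}
    (hg : MemLp g 2 (volume.restrict (Set.Icc a b))) {p : MvPolynomial (Fin N) 𝕜}
    (hp : IsMomentPoly d (Set.Icc a b) g p) :
    eLpNorm (g - polyFun p) 2 (volume.restrict (Set.Icc a b)) = polyDist d (Set.Icc a b) g := by
  refine le_antisymm (le_iInf₂ fun q hq => ?_) (polyDist_le hp.1)
  have hgp := hg.sub (memLp_polyFun isCompact_Icc p)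
  have hpq := memLp_polyFun (isCompact_Icc (a := a) (b := b)) (p - q)
  have horth : inner 𝕜 (hgp.toLp _) (hpq.toLp _) = 0 :=
    (hp.2.congr_ae hgp.coeFn_toLp.symm).inner_polyFun
      ((MvPolynomial.totalDegree_sub p q).trans (max_le hp.1 hq))
  have hsplit : g - polyFun q = (g - polyFun p) + polyFun (p - q) := by
    ext x
    simp only [Pi.add_apply, Pi.sub_apply, polyFun_sub, sub_add_sub_cancel]
  rw [hsplit, ← Lp.enorm_toLp hgp, ← Lp.enorm_toLp (hgp.add hpq), MemLp.toLp_add hgp hpq]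
  exact enorm_le_enorm_add_of_inner_eq_zero horth

lemma exists_isMomentPoly (d : ℕ) (a : Fin N → ℝ) {ℓ : ℝ} (hℓ : 0 < ℓ) {g : (Fin N → ℝ) → 𝕜}
    (hg : LocallySquareIntegrable g) : ∃ p, IsMomentPoly d (cube a ℓ) g p :=
  (existsUnique_isMomentPoly d hℓ
    (integrableOn_of_memLp_two isCompact_Icc (hg _ isCompact_Icc))).exists

lemma eLpNorm_sub_momentPoly (d : ℕ) (a : Fin N → ℝ) {ℓ : ℝ} (hℓ : 0 < ℓ)
    {g : (Fin N → ℝ) → 𝕜} (hg : LocallySquareIntegrable g) :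
    eLpNorm (g - polyFun (momentPoly d (cube a ℓ) g)) 2 (volume.restrict (cube a ℓ)) =
      polyDist d (cube a ℓ) g := by
  have hex := exists_isMomentPoly d a hℓ hg
  rw [momentPoly, dif_pos hex]
  exact hex.choose_spec.eLpNorm_sub_eq_polyDist (hg _ isCompact_Icc)

end Polynomials

section Rescaling

variable {𝕜 : Type*} [RCLike 𝕜] {N d : ℕ} {r : ℝ}

/-- The affine map `y ↦ r (y - t)`, whose inverse `x ↦ r⁻¹ x + t` for `r = 2 ^ (-n)`, `t = k` is
the change of variables in `dilatedSpline`. -/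
def rescale (r : ℝ) (t y : Fin N → ℝ) : Fin N → ℝ := r • (y - t)

lemma rescale_apply (r : ℝ) (t y : Fin N → ℝ) (i : Fin N) :
    rescale r t y i = r * (y i - t i) := rfl

lemma isHomeomorph_rescale (hr : r ≠ 0) (t : Fin N → ℝ) : IsHomeomorph (rescale r t) :=
  ((Homeomorph.subRight t).trans (Homeomorph.smulOfNeZero r hr)).isHomeomorph

lemma measurableEmbedding_rescale (hr : r ≠ 0) (t : Fin N → ℝ) :
    MeasurableEmbedding (rescale r t) :=
  (isHomeomorph_rescale hr t).isClosedEmbedding.measurableEmbedding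

lemma map_rescale_volume (hr : 0 < r) (t : Fin N → ℝ) :
    Measure.map (rescale r t) volume = ENNReal.ofReal (r ^ N)⁻¹ • volume := by
  have hcomp : rescale r t = (r • ·) ∘ (· - t) := rfl
  rw [hcomp, ← Measure.map_map (measurable_const_smul r) (measurable_sub_const t),
    map_sub_right_eq_self, Measure.map_addHaar_smul _ hr.ne', Module.finrank_fin_fun,
    abs_of_pos (inv_pos.2 (pow_pos hr N))]

lemma map_rescale_volume_restrict (hr : 0 < r) (t : Fin N → ℝ) (Q : Set (Fin N → ℝ)) :
    Measure.map (rescale r t) (volume.restrict (rescale r t ⁻¹' Q)) =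
      ENNReal.ofReal (r ^ N)⁻¹ • volume.restrict Q := by
  rw [← (measurableEmbedding_rescale hr.ne' t).restrict_map, map_rescale_volume hr,
    Measure.restrict_smul]

lemma preimage_rescale_cube (hr : 0 < r) (t a : Fin N → ℝ) (ℓ : ℝ) :
    rescale r t ⁻¹' cube (rescale r t a) (r * ℓ) = cube a ℓ := by
  ext y
  simp only [cube, Set.mem_preimage, Set.mem_Icc, Pi.le_def, rescale_apply, ← mul_add,
    mul_le_mul_iff_right₀ hr, sub_le_sub_iff_right, sub_add_eq_add_sub]

lemma LocallySquareIntegrable.comp_rescale {g : (Fin N → ℝ) → 𝕜} (hg : LocallySquareIntegrable g)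
    (hr : 0 < r) (t : Fin N → ℝ) : LocallySquareIntegrable (g ∘ rescale r t) := by
  intro K hK
  have hTK : IsCompact (rescale r t '' K) := hK.image (isHomeomorph_rescale hr.ne' t).continuous
  have hKT : rescale r t ⁻¹' (rescale r t '' K) = K :=
    (isHomeomorph_rescale hr.ne' t).injective.preimage_image K
  rw [← hKT, ← (measurableEmbedding_rescale hr.ne' t).memLp_map_measure_iff,
    map_rescale_volume_restrict hr]
  exact (hg _ hTK).smul_measure ENNReal.ofReal_ne_top

lemma eLpNorm_comp_rescale (hr : 0 < r) (t : Fin N → ℝ) (Q : Set (Fin N → ℝ))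
    (f : (Fin N → ℝ) → 𝕜) :
    eLpNorm (f ∘ rescale r t) 2 (volume.restrict (rescale r t ⁻¹' Q)) =
      ENNReal.ofReal (r ^ (-(N / 2 : ℝ))) * eLpNorm f 2 (volume.restrict Q) := by
  rw [← (measurableEmbedding_rescale hr.ne' t).eLpNorm_map_measure,
    map_rescale_volume_restrict hr, eLpNorm_smul_measure_of_ne_top ENNReal.ofNat_ne_top,
    smul_eq_mul, ENNReal.ofReal_rpow_of_pos (by positivity), ← Real.rpow_natCast,
    ← Real.rpow_neg hr.le, ← Real.rpow_mul hr.le]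
  congr 3
  simp [div_eq_mul_inv]

lemma integral_comp_rescale (hr : 0 < r) (t : Fin N → ℝ) (f : (Fin N → ℝ) → 𝕜) :
    ∫ x, f x = ((r ^ N : ℝ) : 𝕜) * ∫ y, f (rescale r t y) := by
  rw [← (measurableEmbedding_rescale hr.ne' t).integral_map, map_rescale_volume hr,
    integral_smul_measure, ENNReal.toReal_ofReal (by positivity), ← RCLike.real_smul_eq_coe_mul,
    smul_inv_smul₀ (by positivity)]

lemma polyDist_comp_rescale (hr : 0 < r) (t : Fin N → ℝ) (Q : Set (Fin N → ℝ))
    (g : (Fin N → ℝ) → 𝕜) :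
    polyDist d (rescale r t ⁻¹' Q) (g ∘ rescale r t) =
      ENNReal.ofReal (r ^ (-(N / 2 : ℝ))) * polyDist d Q g := by
  have hc : ENNReal.ofReal (r ^ (-(N / 2 : ℝ))) ≠ 0 :=
    (ENNReal.ofReal_pos.2 (Real.rpow_pos_of_pos hr _)).ne'
  have hcomp (p q : MvPolynomial (Fin N) 𝕜) (hqp : polyFun q = polyFun p ∘ rescale r t) :
      eLpNorm (g ∘ rescale r t - polyFun q) 2 (volume.restrict (rescale r t ⁻¹' Q)) =
        ENNReal.ofReal (r ^ (-(N / 2 : ℝ))) * eLpNorm (g - polyFun p) 2 (volume.restrict Q) := by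
    rw [hqp, ← eLpNorm_comp_rescale hr]
    rfl
  simp_rw [polyDist, ENNReal.mul_iInf_of_ne hc ENNReal.ofReal_ne_top]
  refine le_antisymm (le_iInf₂ fun p hp => ?_) (le_iInf₂ fun q hq => ?_)
  · obtain ⟨q, hq, hqp⟩ := exists_polyFun_eq_comp_affine r (-(r • t)) p
    refine iInf₂_le_of_le q (hq.trans hp) (hcomp p q ?_).le
    simp only [hqp, funext_iff, Function.comp_apply, rescale, smul_sub, ← sub_eq_add_neg,
      implies_true]
  · obtain ⟨p, hp, hpq⟩ := exists_polyFun_eq_comp_affine r⁻¹ t q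
    refine iInf₂_le_of_le p (hp.trans hq) (hcomp p q ?_).ge
    simp only [hpq, funext_iff, Function.comp_apply, rescale, inv_smul_smul₀ hr.ne',
      sub_add_cancel, implies_true]

end Rescaling

section Oscillation

variable {𝕜 : Type*} [RCLike 𝕜] {N : ℕ} {α : ℝ}

lemma ofReal_rpow_mul_ofReal_rpow_mul {r : ℝ} (hr : 0 < r) (s t : ℝ) (x : ℝ≥0∞) :
    ENNReal.ofReal (r ^ s) * (ENNReal.ofReal (r ^ t) * x) = ENNReal.ofReal (r ^ (s + t)) * x := by
  rw [← mul_assoc, ← ENNReal.ofReal_mul (Real.rpow_nonneg hr.le s), Real.rpow_add hr]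

lemma volume_cube (a : Fin N → ℝ) (ℓ : ℝ) : volume (cube a ℓ) = ENNReal.ofReal ℓ ^ N := by
  simp [cube, Real.volume_Icc_pi]

lemma lipNorm_eq_iSup {J : Set (Set (Fin N → ℝ))} (hJ : ∀ Q ∈ J, volume Q ≠ 0)
    (g : (Fin N → ℝ) → 𝕜) : lipNorm α J g = ⨆ Q ∈ J, oscillation α g Q := by
  refine le_antisymm (essSup_le_of_ae_le _ (Filter.Eventually.of_forall fun x => ?_))
    (iSup₂_le fun Q hQ => ?_)
  · exact iSup₂_mono fun Q _ => iSup_le fun _ => le_rfl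
  · obtain ⟨x, hx, hle⟩ := ((frequently_ae_mem_iff.2 (hJ Q hQ)).and_eventually
      (ENNReal.ae_le_essSup (μ := volume) (sharpMaximal α J g))).exists
    refine le_trans ?_ hle
    exact le_iSup₂_of_le Q hQ (le_iSup (fun _ : x ∈ Q => oscillation α g Q) hx)

lemma volume_ne_zero_of_mem_allCubes {Q : Set (Fin N → ℝ)} (hQ : Q ∈ allCubes N) :
    volume Q ≠ 0 := by
  obtain ⟨a, ℓ, hℓ, rfl⟩ := hQ
  rw [volume_cube]
  exact pow_ne_zero _ (ENNReal.ofReal_pos.2 hℓ).ne'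

lemma mem_dyadicCubes_iff {Q : Set (Fin N → ℝ)} : Q ∈ dyadicCubes N ↔
    ∃ (n : ℤ) (k : Fin N → ℤ), Q = cube (fun i => (k i - 1) * 2 ^ n) (2 ^ n) := by
  simp only [dyadicCubes, Set.mem_ofPred_eq, cube, sub_mul, one_mul, sub_add_cancel]

lemma dyadicCubes_subset_allCubes : dyadicCubes N ⊆ allCubes N := by
  intro Q hQ
  obtain ⟨n, k, rfl⟩ := mem_dyadicCubes_iff.1 hQ
  exact ⟨_, 2 ^ n, by positivity, rfl⟩

lemma oscillation_le_lipNorm {J : Set (Set (Fin N → ℝ))} (hJ : J ⊆ allCubes N)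
    (g : (Fin N → ℝ) → 𝕜) {Q : Set (Fin N → ℝ)} (hQ : Q ∈ J) :
    oscillation α g Q ≤ lipNorm α J g := by
  rw [lipNorm_eq_iSup fun Q hQ => volume_ne_zero_of_mem_allCubes (hJ hQ)]
  exact le_iSup₂ (f := fun Q (_ : Q ∈ J) => oscillation α g Q) Q hQ

lemma lipNorm_mono {J K : Set (Set (Fin N → ℝ))} (hJK : J ⊆ K) (hK : K ⊆ allCubes N)
    (g : (Fin N → ℝ) → 𝕜) : lipNorm α J g ≤ lipNorm α K g := by
  rw [lipNorm_eq_iSup fun Q hQ => volume_ne_zero_of_mem_allCubes (hK (hJK hQ))]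
  exact iSup₂_le fun Q hQ => oscillation_le_lipNorm hK g (hJK hQ)

variable [NeZero N]

lemma oscillation_cube (α : ℝ) {g : (Fin N → ℝ) → 𝕜} (hg : LocallySquareIntegrable g)
    (a : Fin N → ℝ) {ℓ : ℝ} (hℓ : 0 < ℓ) :
    oscillation α g (cube a ℓ) =
      ENNReal.ofReal (ℓ ^ (-(α + N / 2))) * polyDist ⌊α⌋₊ (cube a ℓ) g := by
  have hN : (N : ℝ) ≠ 0 := NeZero.ne _
  have hℓ0 : ENNReal.ofReal ℓ ≠ 0 := (ENNReal.ofReal_pos.2 hℓ).ne'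
  rw [← eLpNorm_sub_momentPoly _ a hℓ hg, oscillation, volume_cube,
    eLpNorm_eq_lintegral_rpow_enorm_toReal two_ne_zero ENNReal.ofNat_ne_top,
    ENNReal.mul_rpow_of_nonneg _ _ (by norm_num), ← mul_assoc]
  congr 1
  · rw [← ENNReal.ofReal_rpow_of_pos hℓ, ← ENNReal.rpow_natCast, ← ENNReal.rpow_mul, one_div,
      one_div, ← ENNReal.rpow_neg, ← ENNReal.rpow_neg, ← ENNReal.rpow_mul,
      ← ENNReal.rpow_add _ _ hℓ0 ENNReal.ofReal_ne_top]
    congr 1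
    field_simp
    ring
  · simp only [Pi.sub_apply, ENNReal.toReal_ofNat, ENNReal.rpow_ofNat]

lemma oscillation_comp_rescale (α : ℝ) {g : (Fin N → ℝ) → 𝕜} (hg : LocallySquareIntegrable g)
    {r : ℝ} (hr : 0 < r) (t a : Fin N → ℝ) {ℓ : ℝ} (hℓ : 0 < ℓ) :
    oscillation α (g ∘ rescale r t) (cube a ℓ) =
      ENNReal.ofReal (r ^ α) * oscillation α g (cube (rescale r t a) (r * ℓ)) := by
  rw [oscillation_cube α (hg.comp_rescale hr t) a hℓ, oscillation_cube α hg _ (mul_pos hr hℓ),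
    ← preimage_rescale_cube hr t a ℓ, polyDist_comp_rescale hr, Real.mul_rpow hr.le hℓ.le,
    ENNReal.ofReal_mul (by positivity), mul_assoc, ofReal_rpow_mul_ofReal_rpow_mul hr,
    mul_left_comm]
  congr 4
  ring

lemma oscillation_le_of_cube_subset_cube (α : ℝ) {g : (Fin N → ℝ) → 𝕜}
    (hg : LocallySquareIntegrable g) {a a' : Fin N → ℝ} {ℓ ℓ' : ℝ} (hℓ : 0 < ℓ) (hℓ' : 0 < ℓ')
    (h : cube a ℓ ⊆ cube a' ℓ') :
    oscillation α g (cube a ℓ) ≤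
      ENNReal.ofReal ((ℓ' / ℓ) ^ (α + N / 2)) * oscillation α g (cube a' ℓ') := by
  rw [oscillation_cube α hg a hℓ, oscillation_cube α hg a' hℓ', Real.div_rpow hℓ'.le hℓ.le,
    div_eq_mul_inv (ℓ' ^ _), ← Real.rpow_neg hℓ.le, mul_comm (ℓ' ^ _),
    ENNReal.ofReal_mul (by positivity), mul_assoc, ofReal_rpow_mul_ofReal_rpow_mul hℓ',
    add_neg_cancel, Real.rpow_zero, ENNReal.ofReal_one, one_mul]
  gcongr
  exact polyDist_mono h g

end Oscillation

section Splines

variable {𝕜 : Type*} [RCLike 𝕜] {N d : ℕ}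

lemma unitCube_eq_cube : unitCube N = cube (fun _ => -1) 2 := by
  simp only [unitCube, cube]
  norm_num

lemma subcube_eq_cube (S : Fin N → Bool) :
    subcube S = cube (fun i => if S i then 0 else -1) 1 := by
  simp only [subcube, cube]
  congr! 2 with i
  split_ifs <;> norm_num

lemma isCompact_unitCube : IsCompact (unitCube N) := isCompact_Icc

/-- The orthant of `ℝ^N` that contains `x`; the coordinate hyperplanes count as nonnegative. -/
noncomputable def orthant (x : Fin N → ℝ) : Fin N → Bool := fun i => decide (0 ≤ x i)

lemma measurable_orthant : Measurable (orthant : (Fin N → ℝ) → Fin N → Bool) :=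
  measurable_pi_lambda _ fun i => measurable_to_bool <| by
    simpa only [orthant, Set.preimage, Set.mem_singleton_iff, decide_eq_true_eq] using
      measurableSet_le measurable_const (measurable_pi_apply i)

lemma orthant_ae_eq (S : Fin N → Bool) : ∀ᵐ x ∂volume.restrict (subcube S), orthant x = S := by
  have hne : ∀ᵐ x : Fin N → ℝ, ∀ i, x i ≠ 0 := ae_all_iff.2 fun i => by
    simpa only [ae_iff, ne_eq, not_not, volume_pi] using
      Measure.pi_hyperplane (fun _ : Fin N => (volume : Measure ℝ)) i 0
  filter_upwards [ae_restrict_of_ae hne, ae_restrict_mem (s := subcube S) measurableSet_Icc]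
    with x hx hxS
  ext i
  have hl := hxS.1 i
  have hu := hxS.2 i
  cases hS : S i
  · simp only [hS, Bool.false_eq_true, if_false] at hu
    simpa only [orthant, decide_eq_false_iff_not, not_le] using lt_of_le_of_ne hu (hx i)
  · simp only [hS, if_true] at hl
    simpa only [orthant, decide_eq_true_eq] using hl

lemma unitCube_subset_iUnion_subcube : unitCube N ⊆ ⋃ S : Fin N → Bool, subcube S := by
  intro x hx
  refine Set.mem_iUnion.2 ⟨orthant x, fun i => ?_, fun i => ?_⟩
  · by_cases h : 0 ≤ x i
    · simp [orthant, h]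
    · simpa [orthant, h] using hx.1 i
  · by_cases h : 0 ≤ x i
    · simpa [orthant, h] using hx.2 i
    · simpa [orthant, h] using (not_le.1 h).le

lemma eLpNorm_two_restrict_le_sum {X E ι : Type*} [MeasurableSpace X] {μ : Measure X}
    [NormedAddCommGroup E] [Fintype ι] {s : Set X} {t : ι → Set X} (h : s ⊆ ⋃ i, t i)
    (f : X → E) : eLpNorm f 2 (μ.restrict s) ≤ ∑ i, eLpNorm f 2 (μ.restrict (t i)) := by
  have hsq (ν : Measure X) : eLpNorm f 2 ν ^ 2 = ∫⁻ x, ‖f x‖ₑ ^ 2 ∂ν := by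
    simpa using eLpNorm_nnreal_pow_eq_lintegral (p := 2) (f := f) (μ := ν) two_ne_zero
  rw [← ENNReal.pow_le_pow_left_iff two_ne_zero]
  calc eLpNorm f 2 (μ.restrict s) ^ 2
      = ∫⁻ x in s, ‖f x‖ₑ ^ 2 ∂μ := hsq _
    _ ≤ ∫⁻ x in ⋃ i, t i, ‖f x‖ₑ ^ 2 ∂μ := lintegral_mono_set h
    _ ≤ ∑' i, ∫⁻ x in t i, ‖f x‖ₑ ^ 2 ∂μ := lintegral_iUnion_le _ _
    _ = ∑ i, eLpNorm f 2 (μ.restrict (t i)) ^ 2 := by simp only [tsum_fintype, hsq]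
    _ ≤ (∑ i, eLpNorm f 2 (μ.restrict (t i))) ^ 2 :=
        Finset.sum_sq_le_sq_sum_of_nonneg fun _ _ => zero_le

/-- The function that agrees with `p S` on the interior of the orthant `S`. -/
noncomputable def piecewisePoly (p : (Fin N → Bool) → MvPolynomial (Fin N) 𝕜)
    (x : Fin N → ℝ) : 𝕜 :=
  polyFun (p (orthant x)) x

lemma locallySquareIntegrable_piecewisePoly (p : (Fin N → Bool) → MvPolynomial (Fin N) 𝕜) :
    LocallySquareIntegrable (piecewisePoly p) := by
  have hsum : piecewisePoly p =
      fun x => ∑ S, (orthant ⁻¹' {S}).indicator (polyFun (p S)) x := by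
    classical
    ext x
    simp [piecewisePoly, Set.indicator_apply]
  rw [hsum]
  exact fun K hK => memLp_finsetSum _ fun S _ =>
    (memLp_polyFun hK (p S)).indicator (measurable_orthant (measurableSet_singleton S))

lemma piecewisePoly_ae_eq (p : (Fin N → Bool) → MvPolynomial (Fin N) 𝕜) (S : Fin N → Bool) :
    piecewisePoly p =ᵐ[volume.restrict (subcube S)] polyFun (p S) :=
  (orthant_ae_eq S).mono fun x hx => by rw [piecewisePoly, hx]

lemma eLpNorm_sub_piecewisePoly_le (f : (Fin N → ℝ) → 𝕜)
    (p : (Fin N → Bool) → MvPolynomial (Fin N) 𝕜) :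
    eLpNorm (f - piecewisePoly p) 2 (volume.restrict (unitCube N)) ≤
      ∑ S, eLpNorm (f - polyFun (p S)) 2 (volume.restrict (subcube S)) :=
  (eLpNorm_two_restrict_le_sum unitCube_subset_iUnion_subcube _).trans_eq <|
    Finset.sum_congr rfl fun S _ =>
      eLpNorm_congr_ae (Filter.EventuallyEq.rfl.sub (piecewisePoly_ae_eq p S))

lemma toLp_polyFun_mem_splineSpace_orthogonal {q : MvPolynomial (Fin N) 𝕜}
    (hq : q.totalDegree ≤ d) :
    (memLp_polyFun isCompact_unitCube q).toLp (polyFun q) ∈ (splineSpace 𝕜 N d)ᗮ :=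
  (Submodule.mem_orthogonal _ _).2 fun _ hf => hf.1.inner_polyFun hq

lemma toLp_piecewisePoly_sub_mem_splineSpace {p : (Fin N → Bool) → MvPolynomial (Fin N) 𝕜}
    (hp : ∀ S, (p S).totalDegree ≤ d) {q : MvPolynomial (Fin N) 𝕜}
    (hq : IsMomentPoly d (unitCube N) (piecewisePoly p) q) :
    ((locallySquareIntegrable_piecewisePoly p _ isCompact_unitCube).sub
      (memLp_polyFun isCompact_unitCube q)).toLp (piecewisePoly p - polyFun q) ∈
      splineSpace 𝕜 N d := by
  have hcoe := ((locallySquareIntegrable_piecewisePoly p _ isCompact_unitCube).sub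
    (memLp_polyFun isCompact_unitCube q)).coeFn_toLp
  refine ⟨hq.2.congr_ae hcoe.symm, fun S => ⟨p S - q,
    (MvPolynomial.totalDegree_sub _ _).trans (max_le (hp S) hq.1), ?_⟩⟩
  filter_upwards [ae_restrict_of_ae_restrict_of_subset (subcube_subset S) hcoe,
    piecewisePoly_ae_eq p S] with x hx hxS
  rw [hx, Pi.sub_apply, hxS, polyFun_sub]

variable {ι : Type*} [Fintype ι] {g : (Fin N → ℝ) → 𝕜}

lemma enorm_integral_mul_conj_le_polyDist (b : OrthonormalBasis ι 𝕜 (splineSpace 𝕜 N d))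
    (hg : MemLp g 2 (volume.restrict (unitCube N))) (L : ι) :
    ‖∫ x in unitCube N, g x * starRingEnd 𝕜 ((b L).1 x)‖ₑ ≤ polyDist d (unitCube N) g := by
  refine le_iInf₂ fun q hq => ?_
  have hq' := memLp_polyFun isCompact_unitCube q
  rw [← inner_toLp _ hg, ← Lp.enorm_toLp (hg.sub hq'), MemLp.toLp_sub hg hq']
  exact enorm_inner_le_enorm_sub (b.orthonormal.1 L) ((b L).2.1.inner_polyFun hq)

/-- Glue the best approximations on the subcubes to a piecewise polynomial, and let `q` be its
moment polynomial on `Q₀`; their difference lies in the spline space, to which `q` is orthogonal. -/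
theorem polyDist_unitCube_le (b : OrthonormalBasis ι 𝕜 (splineSpace 𝕜 N d))
    (hg : LocallySquareIntegrable g) :
    polyDist d (unitCube N) g ≤ ∑ S, polyDist d (subcube S) g +
      ∑ L, ‖∫ x in unitCube N, g x * starRingEnd 𝕜 ((b L).1 x)‖ₑ := by
  have hexS (S : Fin N → Bool) : ∃ p, IsMomentPoly d (subcube S) g p := by
    rw [subcube_eq_cube]
    exact exists_isMomentPoly d _ one_pos hg
  choose p hp using hexS
  obtain ⟨q, hq⟩ : ∃ q, IsMomentPoly d (unitCube N) (piecewisePoly p) q := by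
    rw [unitCube_eq_cube]
    exact exists_isMomentPoly d _ two_pos (locallySquareIntegrable_piecewisePoly p)
  have hgL := hg _ isCompact_unitCube
  have huL := locallySquareIntegrable_piecewisePoly p _ isCompact_unitCube
  have hqL := memLp_polyFun isCompact_unitCube q
  calc polyDist d (unitCube N) g
      ≤ ‖hgL.toLp g - hqL.toLp (polyFun q)‖ₑ := by
        rw [← MemLp.toLp_sub, Lp.enorm_toLp]
        exact polyDist_le hq.1
    _ ≤ ‖hgL.toLp g - huL.toLp (piecewisePoly p)‖ₑ +
          ‖(splineSpace 𝕜 N d).starProjection (hgL.toLp g)‖ₑ := by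
        refine enorm_sub_le_of_mem_orthogonal (toLp_polyFun_mem_splineSpace_orthogonal hq.1) ?_
        rw [← MemLp.toLp_sub]
        exact toLp_piecewisePoly_sub_mem_splineSpace (fun S => (hp S).1) hq
    _ ≤ ∑ S, polyDist d (subcube S) g +
          ∑ L, ‖∫ x in unitCube N, g x * starRingEnd 𝕜 ((b L).1 x)‖ₑ := by
        gcongr
        · rw [← MemLp.toLp_sub, Lp.enorm_toLp]
          exact (eLpNorm_sub_piecewisePoly_le g p).trans_eq <|
            Finset.sum_congr rfl fun S _ => (hp S).eLpNorm_sub_eq_polyDist (hg _ isCompact_Icc)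
        · refine (enorm_starProjection_le_sum b _).trans_eq <| Finset.sum_congr rfl fun L _ => ?_
          rw [inner_toLp]

end Splines

section UnitScale

variable {𝕜 ι : Type*} [RCLike 𝕜] [Fintype ι] {N : ℕ} [NeZero N] {α : ℝ} {g : (Fin N → ℝ) → 𝕜}

lemma oscillation_unitCube (α : ℝ) (hg : LocallySquareIntegrable g) :
    oscillation α g (unitCube N) =
      ENNReal.ofReal (2 ^ (-(α + N / 2))) * polyDist ⌊α⌋₊ (unitCube N) g := by
  rw [unitCube_eq_cube, oscillation_cube α hg _ two_pos]

lemma oscillation_subcube (α : ℝ) (hg : LocallySquareIntegrable g) (S : Fin N → Bool) :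
    oscillation α g (subcube S) = polyDist ⌊α⌋₊ (subcube S) g := by
  rw [subcube_eq_cube, oscillation_cube α hg _ one_pos, Real.one_rpow, ENNReal.ofReal_one, one_mul]

lemma enorm_integral_mul_conj_le_oscillation
    (b : OrthonormalBasis ι 𝕜 (splineSpace 𝕜 N ⌊α⌋₊)) (hg : LocallySquareIntegrable g) (L : ι) :
    ‖∫ x in unitCube N, g x * starRingEnd 𝕜 ((b L).1 x)‖ₑ ≤
      ENNReal.ofReal (2 ^ (α + N / 2)) * oscillation α g (unitCube N) := by
  rw [oscillation_unitCube α hg, ofReal_rpow_mul_ofReal_rpow_mul two_pos, add_neg_cancel,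
    Real.rpow_zero, ENNReal.ofReal_one, one_mul]
  exact enorm_integral_mul_conj_le_polyDist b (hg _ isCompact_unitCube) L

lemma oscillation_unitCube_le (b : OrthonormalBasis ι 𝕜 (splineSpace 𝕜 N ⌊α⌋₊))
    (hg : LocallySquareIntegrable g) :
    oscillation α g (unitCube N) ≤ ENNReal.ofReal (2 ^ (-(α + N / 2))) *
      (∑ S, oscillation α g (subcube S) +
        ∑ L, ‖∫ x in unitCube N, g x * starRingEnd 𝕜 ((b L).1 x)‖ₑ) := by
  simp only [oscillation_unitCube α hg, oscillation_subcube α hg]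
  gcongr
  exact polyDist_unitCube_le b hg

end UnitScale

section DyadicScale

variable {𝕜 : Type*} [RCLike 𝕜] {N : ℕ} {α : ℝ} {g : (Fin N → ℝ) → 𝕜}

/-- The cube `{x | 2 ^ n x + k ∈ Q₀}` that supports the splines `dilatedSpline α p n k`, written
with the inverse of the map `x ↦ 2 ^ n x + k`. -/
def splineCube (n : ℤ) (k : Fin N → ℤ) : Set (Fin N → ℝ) :=
  cube (rescale (2 ^ (-n)) (fun i => (k i : ℝ)) fun _ => -1) (2 ^ (-n) * 2)

lemma dilatedSpline_rescale (α : ℝ) (p : Lp 𝕜 2 (volume.restrict (unitCube N))) (n : ℤ)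
    (k : Fin N → ℤ) (y : Fin N → ℝ) :
    dilatedSpline α p n k (rescale (2 ^ (-n)) (fun i => (k i : ℝ)) y) =
      ((((2 : ℝ) ^ (-n)) ^ (-(N + α)) : ℝ) : 𝕜) * (unitCube N).indicator p y := by
  have hy : (fun i => 2 ^ n * rescale (2 ^ (-n)) (fun i => (k i : ℝ)) y i + k i) = y := by
    ext i
    rw [rescale_apply, ← mul_assoc, ← zpow_add₀ two_ne_zero, add_neg_cancel, zpow_zero, one_mul,
      sub_add_cancel]
  have hc : ((2 : ℝ) ^ (-n)) ^ (-(N + α)) = 2 ^ ((n : ℝ) * (N + α)) := by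
    rw [← Real.rpow_intCast, ← Real.rpow_mul zero_le_two, Int.cast_neg, neg_mul_neg]
  rw [dilatedSpline, hy, hc]

lemma pairing_dilatedSpline (α : ℝ) (p : Lp 𝕜 2 (volume.restrict (unitCube N)))
    (n : ℤ) (k : Fin N → ℤ) (g : (Fin N → ℝ) → 𝕜) :
    pairing g (dilatedSpline α p n k) = ((((2 : ℝ) ^ (-n)) ^ (-α) : ℝ) : 𝕜) *
      ∫ y in unitCube N,
        (g ∘ rescale (2 ^ (-n)) fun i => (k i : ℝ)) y * starRingEnd 𝕜 (p y) := by
  have hr : (0 : ℝ) < 2 ^ (-n) := by positivity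
  have hintegrand (y : Fin N → ℝ) :
      g (rescale (2 ^ (-n)) (fun i => (k i : ℝ)) y) *
          starRingEnd 𝕜 (dilatedSpline α p n k (rescale (2 ^ (-n)) (fun i => (k i : ℝ)) y)) =
        ((((2 : ℝ) ^ (-n)) ^ (-(N + α)) : ℝ) : 𝕜) * (unitCube N).indicator
          (fun y => (g ∘ rescale (2 ^ (-n)) fun i => (k i : ℝ)) y * starRingEnd 𝕜 (p y)) y := by
    rw [dilatedSpline_rescale, map_mul, RCLike.conj_ofReal, mul_left_comm]
    by_cases hy : y ∈ unitCube N
    · simp only [Set.indicator_of_mem hy, Function.comp_apply]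
    · simp only [Set.indicator_of_notMem hy, map_zero, mul_zero]
  rw [pairing, integral_comp_rescale hr fun i => (k i : ℝ)]
  simp_rw [hintegrand]
  rw [integral_const_mul, integral_indicator isCompact_unitCube.measurableSet, ← mul_assoc,
    ← RCLike.ofReal_mul, ← Real.rpow_natCast, ← Real.rpow_add hr, neg_add,
    add_neg_cancel_left]

lemma enorm_integral_comp_rescale_mul_conj (α : ℝ) (p : Lp 𝕜 2 (volume.restrict (unitCube N)))
    (n : ℤ) (k : Fin N → ℤ) (g : (Fin N → ℝ) → 𝕜) :
    ‖∫ y in unitCube N, (g ∘ rescale (2 ^ (-n)) fun i => (k i : ℝ)) y * starRingEnd 𝕜 (p y)‖ₑ =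
      ENNReal.ofReal ((2 ^ (-n)) ^ α) * ‖pairing g (dilatedSpline α p n k)‖ₑ := by
  have hr : (0 : ℝ) < 2 ^ (-n) := by positivity
  rw [pairing_dilatedSpline, enorm_mul, ← ofReal_norm (RCLike.ofReal _ : 𝕜), RCLike.norm_ofReal,
    abs_of_pos (Real.rpow_pos_of_pos hr _), ofReal_rpow_mul_ofReal_rpow_mul hr, add_neg_cancel,
    Real.rpow_zero, ENNReal.ofReal_one, one_mul]

lemma enorm_pairing_le_splineSup {M : ℕ} (b : OrthonormalBasis (Fin M) 𝕜 (splineSpace 𝕜 N ⌊α⌋₊))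
    (g : (Fin N → ℝ) → 𝕜) (n : ℤ) (k : Fin N → ℤ) (L : Fin M) :
    ‖pairing g (dilatedSpline α (b L).1 n k)‖ₑ ≤ splineSup α b g :=
  le_iSup₂ (f := fun s (_ : s ∈ specialSplines α b) => ‖pairing g s‖ₑ) _ ⟨n, k, L, rfl⟩

lemma exists_cube_subset_splineCube (a : Fin N → ℝ) {ℓ : ℝ} (hℓ : 0 < ℓ) :
    ∃ (n : ℤ) (k : Fin N → ℤ), cube a ℓ ⊆ splineCube n k ∧
      (2 : ℝ) ^ (-n) * 2 / ℓ ∈ Set.Icc 1 4 := by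
  obtain ⟨m, hm, hm'⟩ := exists_mem_Ioc_zpow hℓ one_lt_two
  have hr : (0 : ℝ) < 2 ^ (m + 1) := by positivity
  have hrℓ : (2 : ℝ) ^ (m + 1) < 2 * ℓ := by
    rw [zpow_add_one₀ two_ne_zero]
    linarith
  refine ⟨-(m + 1), fun i => -⌊a i / 2 ^ (m + 1)⌋ - 1, ?_, ?_⟩
  · rw [splineCube, neg_neg]
    refine Set.Icc_subset_Icc (fun i => ?_) fun i => ?_
    · have := (le_div_iff₀ hr).1 (Int.floor_le (a i / 2 ^ (m + 1)))
      simp only [rescale_apply]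
      push_cast
      linarith
    · have := (div_lt_iff₀ hr).1 (Int.lt_floor_add_one (a i / 2 ^ (m + 1)))
      simp only [rescale_apply]
      push_cast
      linarith
  · rw [neg_neg, Set.mem_Icc, le_div_iff₀ hℓ, div_le_iff₀ hℓ]
    constructor <;> linarith

variable [NeZero N]

lemma oscillation_comp_rescale_unitCube (α : ℝ) (hg : LocallySquareIntegrable g) (n : ℤ)
    (k : Fin N → ℤ) :
    oscillation α (g ∘ rescale (2 ^ (-n)) fun i => (k i : ℝ)) (unitCube N) =
      ENNReal.ofReal ((2 ^ (-n)) ^ α) * oscillation α g (splineCube n k) := by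
  rw [unitCube_eq_cube, oscillation_comp_rescale α hg (by positivity) _ _ two_pos, splineCube]

lemma oscillation_comp_rescale_subcube_le (hg : LocallySquareIntegrable g) (n : ℤ)
    (k : Fin N → ℤ) (S : Fin N → Bool) :
    oscillation α (g ∘ rescale (2 ^ (-n)) fun i => (k i : ℝ)) (subcube S) ≤
      ENNReal.ofReal ((2 ^ (-n)) ^ α) * lipNorm α (dyadicCubes N) g := by
  rw [subcube_eq_cube, oscillation_comp_rescale α hg (by positivity) _ _ one_pos]
  gcongr
  refine oscillation_le_lipNorm dyadicCubes_subset_allCubes g (mem_dyadicCubes_iff.2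
    ⟨-n, fun i => (if S i then 0 else -1) - k i + 1, ?_⟩)
  rw [mul_one]
  congr 1
  ext i
  rw [rescale_apply, mul_comm]
  push_cast
  rw [add_sub_cancel_right]

lemma enorm_pairing_le_oscillation {M : ℕ}
    (b : OrthonormalBasis (Fin M) 𝕜 (splineSpace 𝕜 N ⌊α⌋₊)) (hg : LocallySquareIntegrable g)
    (n : ℤ) (k : Fin N → ℤ) (L : Fin M) :
    ‖pairing g (dilatedSpline α (b L).1 n k)‖ₑ ≤
      ENNReal.ofReal (2 ^ (α + N / 2)) * oscillation α g (splineCube n k) := by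
  have hr : (0 : ℝ) < 2 ^ (-n) := by positivity
  have h := enorm_integral_mul_conj_le_oscillation b (hg.comp_rescale hr fun i => (k i : ℝ)) L
  rw [enorm_integral_comp_rescale_mul_conj, oscillation_comp_rescale_unitCube α hg,
    mul_left_comm] at h
  exact (ENNReal.mul_le_mul_iff_right (by positivity) ENNReal.ofReal_ne_top).1 h

lemma oscillation_splineCube_le {M : ℕ} (b : OrthonormalBasis (Fin M) 𝕜 (splineSpace 𝕜 N ⌊α⌋₊))
    (hg : LocallySquareIntegrable g) (n : ℤ) (k : Fin N → ℤ) :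
    oscillation α g (splineCube n k) ≤ ENNReal.ofReal (2 ^ (-(α + N / 2))) *
      (2 ^ N * lipNorm α (dyadicCubes N) g + M * splineSup α b g) := by
  have hr : (0 : ℝ) < 2 ^ (-n) := by positivity
  have hc : ENNReal.ofReal ((2 ^ (-n)) ^ α) ≠ 0 := by positivity
  rw [← ENNReal.mul_le_mul_iff_right hc ENNReal.ofReal_ne_top,
    ← oscillation_comp_rescale_unitCube α hg, mul_left_comm]
  refine (oscillation_unitCube_le b (hg.comp_rescale hr _)).trans ?_
  gcongr
  calc _ ≤ ∑ _S : Fin N → Bool,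
          ENNReal.ofReal ((2 ^ (-n)) ^ α) * lipNorm α (dyadicCubes N) g +
        ∑ _L : Fin M, ENNReal.ofReal ((2 ^ (-n)) ^ α) * splineSup α b g := by
        gcongr with S _ L
        · exact oscillation_comp_rescale_subcube_le hg n k S
        · rw [enorm_integral_comp_rescale_mul_conj]
          gcongr
          exact enorm_pairing_le_splineSup b g n k L
    _ = ENNReal.ofReal ((2 ^ (-n)) ^ α) *
          (2 ^ N * lipNorm α (dyadicCubes N) g + M * splineSup α b g) := by
        simp only [Finset.sum_const, Finset.card_univ, Fintype.card_fun, Fintype.card_bool,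
          Fintype.card_fin, nsmul_eq_mul, Nat.cast_pow, Nat.cast_ofNat]
        ring

end DyadicScale

section Comparison

variable {𝕜 : Type*} [RCLike 𝕜] {N : ℕ} [NeZero N] {α : ℝ} {g : (Fin N → ℝ) → 𝕜} {M : ℕ}

lemma splineSup_le_lipNorm_allCubes (b : OrthonormalBasis (Fin M) 𝕜 (splineSpace 𝕜 N ⌊α⌋₊))
    (hg : LocallySquareIntegrable g) :
    splineSup α b g ≤ ENNReal.ofReal (2 ^ (α + N / 2)) * lipNorm α (allCubes N) g := by
  refine iSup₂_le fun s ⟨n, k, L, hs⟩ => ?_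
  rw [hs]
  refine (enorm_pairing_le_oscillation b hg n k L).trans ?_
  gcongr
  exact oscillation_le_lipNorm subset_rfl g ⟨_, _, by positivity, rfl⟩

lemma rpow_le_rpow_abs_of_mem_Icc {x y : ℝ} (hx : x ∈ Set.Icc 1 y) (s : ℝ) :
    x ^ s ≤ y ^ |s| :=
  (Real.rpow_le_rpow_of_exponent_le hx.1 (le_abs_self s)).trans
    (Real.rpow_le_rpow (zero_le_one.trans hx.1) hx.2 (abs_nonneg s))

lemma lipNorm_allCubes_le (b : OrthonormalBasis (Fin M) 𝕜 (splineSpace 𝕜 N ⌊α⌋₊))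
    (hg : LocallySquareIntegrable g) :
    lipNorm α (allCubes N) g ≤
      ENNReal.ofReal (4 ^ |α + N / 2|) * (ENNReal.ofReal (2 ^ (-(α + N / 2))) *
        (2 ^ N * lipNorm α (dyadicCubes N) g + M * splineSup α b g)) := by
  rw [lipNorm_eq_iSup fun Q hQ => volume_ne_zero_of_mem_allCubes hQ]
  refine iSup₂_le fun Q ⟨a, ℓ, hℓ, hQ⟩ => ?_
  obtain ⟨n, k, hsub, hratio⟩ := exists_cube_subset_splineCube a hℓ
  calc oscillation α g Q
      ≤ ENNReal.ofReal ((2 ^ (-n) * 2 / ℓ) ^ (α + N / 2)) * oscillation α g (splineCube n k) := by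
        rw [hQ]
        exact oscillation_le_of_cube_subset_cube α hg hℓ (by positivity) hsub
    _ ≤ ENNReal.ofReal (4 ^ |α + N / 2|) * (ENNReal.ofReal (2 ^ (-(α + N / 2))) *
          (2 ^ N * lipNorm α (dyadicCubes N) g + M * splineSup α b g)) := by
        gcongr
        · exact rpow_le_rpow_abs_of_mem_Icc hratio _
        · exact oscillation_splineCube_le b hg n k

lemma lipNorm_dyadicCubes_add_splineSup_le
    (b : OrthonormalBasis (Fin M) 𝕜 (splineSpace 𝕜 N ⌊α⌋₊)) (hg : LocallySquareIntegrable g) :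
    lipNorm α (dyadicCubes N) g + splineSup α b g ≤
      (1 + ENNReal.ofReal (2 ^ (α + N / 2))) * lipNorm α (allCubes N) g := by
  rw [add_mul, one_mul]
  exact add_le_add (lipNorm_mono dyadicCubes_subset_allCubes subset_rfl g)
    (splineSup_le_lipNorm_allCubes b hg)

lemma lipNorm_allCubes_le_mul_add (b : OrthonormalBasis (Fin M) 𝕜 (splineSpace 𝕜 N ⌊α⌋₊))
    (hg : LocallySquareIntegrable g) :
    lipNorm α (allCubes N) g ≤
      ENNReal.ofReal (4 ^ |α + N / 2|) * (ENNReal.ofReal (2 ^ (-(α + N / 2))) *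
        (2 ^ N + Module.finrank 𝕜 (splineSpace 𝕜 N ⌊α⌋₊))) *
          (lipNorm α (dyadicCubes N) g + splineSup α b g) := by
  have hM : Module.finrank 𝕜 (splineSpace 𝕜 N ⌊α⌋₊) = M := by
    rw [Module.finrank_eq_card_basis b.toBasis, Fintype.card_fin]
  refine (lipNorm_allCubes_le b hg).trans ?_
  rw [hM, mul_assoc, mul_assoc]
  gcongr
  rw [add_mul, mul_add, mul_add]
  exact add_le_add le_self_add le_add_self

lemma memLip_allCubes_iff (b : OrthonormalBasis (Fin M) 𝕜 (splineSpace 𝕜 N ⌊α⌋₊))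
    (hg : LocallySquareIntegrable g) :
    MemLip α (allCubes N) g ↔ MemLip α (dyadicCubes N) g ∧ splineSup α b g < ∞ := by
  rw [MemLip, MemLip, and_assoc, ← ENNReal.add_lt_top]
  refine and_congr_right fun _ => ⟨fun h => ?_, fun h => ?_⟩
  · exact (lipNorm_dyadicCubes_add_splineSup_le b hg).trans_lt
      (ENNReal.mul_lt_top (by finiteness) h)
  · exact (lipNorm_allCubes_le_mul_add b hg).trans_lt (ENNReal.mul_lt_top (by finiteness) h)

end Comparison

end DyadicLipschitz

open DyadicLipschitz in
/-- For `α < 0` the natural-number floor is `0`, so `g` is compared with constants. -/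
theorem theoremA_general {𝕜 : Type*} [RCLike 𝕜] (N : ℕ) [NeZero N] (α : ℝ) :
    ∃ c C : ℝ≥0, 0 < c ∧ 0 < C ∧
      ∀ (M : ℕ) (b : OrthonormalBasis (Fin M) 𝕜 (splineSpace 𝕜 N ⌊α⌋₊))
        (g : (Fin N → ℝ) → 𝕜), LocallySquareIntegrable g →
        (MemLip α (allCubes N) g ↔ MemLip α (dyadicCubes N) g ∧ splineSup α b g < ∞) ∧
        (c : ℝ≥0∞) * (lipNorm α (dyadicCubes N) g + splineSup α b g) ≤
          lipNorm α (allCubes N) g ∧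
        lipNorm α (allCubes N) g ≤
          (C : ℝ≥0∞) * (lipNorm α (dyadicCubes N) g + splineSup α b g) := by
  let K : ℝ≥0 := Real.toNNReal (2 ^ (α + N / 2))
  let C : ℝ≥0 := Real.toNNReal (4 ^ |α + N / 2|) * (Real.toNNReal (2 ^ (-(α + N / 2))) *
    (2 ^ N + Module.finrank 𝕜 (splineSpace 𝕜 N ⌊α⌋₊)))
  have hC : 0 < C := by positivity
  refine ⟨(1 + K)⁻¹, C, by positivity, hC, fun M b g hg => ⟨memLip_allCubes_iff b hg, ?_, ?_⟩⟩
  · rw [ENNReal.coe_inv (by positivity), ENNReal.inv_mul_le_iff (by positivity) ENNReal.coe_ne_top]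
    exact lipNorm_dyadicCubes_add_splineSup_le b hg
  · push_cast [C]
    exact lipNorm_allCubes_le_mul_add b hg

theorem theoremA {𝕜 : Type*} [RCLike 𝕜] (N : ℕ) (hN : 1 ≤ N) (α : ℝ) (hα : 0 ≤ α) :
    ∃ c C : ℝ≥0, 0 < c ∧ 0 < C ∧
      ∀ (M : ℕ)
        (b : OrthonormalBasis (Fin M) 𝕜 (DyadicLipschitz.splineSpace 𝕜 N ⌊α⌋₊))
        (g : (Fin N → ℝ) → 𝕜), DyadicLipschitz.LocallySquareIntegrable g →
        (DyadicLipschitz.MemLip α (DyadicLipschitz.allCubes N) g ↔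
          DyadicLipschitz.MemLip α (DyadicLipschitz.dyadicCubes N) g ∧
            DyadicLipschitz.splineSup α b g < ∞) ∧
        (c : ℝ≥0∞) * (DyadicLipschitz.lipNorm α (DyadicLipschitz.dyadicCubes N) g +
            DyadicLipschitz.splineSup α b g) ≤
          DyadicLipschitz.lipNorm α (DyadicLipschitz.allCubes N) g ∧
        DyadicLipschitz.lipNorm α (DyadicLipschitz.allCubes N) g ≤
          (C : ℝ≥0∞) * (DyadicLipschitz.lipNorm α (DyadicLipschitz.dyadicCubes N) g +
            DyadicLipschitz.splineSup α b g) := by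
  have : NeZero N := ⟨Nat.one_le_iff_ne_zero.1 hN⟩
  exact theoremA_general N α
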